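/- Let $X$ be a compact Hausdorff space and let $A\subset C(X)$ be a logmodular algebra on $X$: $A$ is a subalgebra of the algebra of continuous complex-valued functions on $X$ that contains the constants and separates the points of $X$, and the set $\{\log|f| : f\in A,\ f \text{ invertible in } A\}$ is uniformly dense in the space of real continuous functions on $X$. Let $\varphi$ be a (nonzero) multiplicative linear functional on $A$ and let $m$ be its (unique) representing measure, i.e. a regular positive Borel measure on $X$ with $\varphi(f)=\int_X f\,dm$ for all $f\in A$. Let $H^2(m)$ be the closure of $A$ in $L^2(m)$ and $H^\infty(m)$ the weak-star closure of $A$ in $L^\infty(m)=L^1(m)^*$; each $h\in H^\infty(m)$ acts on $H^2(m)$ as the bounded multiplication operator $T_hf=hf$. Suppose that $H^2(m)$ is a reproducing kernel Hilbert space, that is, there are a set $\Omega$ of nonzero multiplicative linear functionals on $A$ and an injective linear map $f\mapsto\hat f$ from $H^2(m)$ to the complex functions on $\Omega$ such that every evaluation $f\mapsto\hat f(\omega)$, $\omega\in\Omega$, is a bounded linear functional on $H^2(m)$, and $\hat a(\omega)=\omega(a)$ for all $a\in A$, $\omega\in\Omega$. Then $H^\infty(m)$ is catalytic on $H^2(m)$: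 every unital subalgebra $\mathcal T$ of $B(H^2(m))$ which contains $\{T_h : h\in H^\infty(m)\}$ and is transitive (its only closed invariant subspaces are $\{0\}$ and $H^2(m)$) is dense in $B(H^2(m))$ in the strong operator topology. -/

import Mathlib

open MeasureTheory
open scoped ENNReal ComplexConjugate

noncomputable section

namespace Logmodular

variable {X : Type*} [TopologicalSpace X] [CompactSpace X]

/-- A uniform algebra on `X`: a subalgebra of `C(X)` which separates the points of `X`. It contains
the constants because it is a (unital) `Subalgebra`. -/
def IsUniformAlgebra (A : Subalgebra ℂ C(X, ℂ)) : Prop :=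
  A.SeparatesPoints

/-- The set `log |A⁻¹|` of all functions `log |f|`, where `f` is an invertible element of `A`. -/
def logAbsUnits (A : Subalgebra ℂ C(X, ℂ)) : Set C(X, ℝ) :=
  {u | ∃ f : Aˣ, ∀ x, u x = Real.log ‖((f : A) : C(X, ℂ)) x‖}

/-- A logmodular algebra on `X`: a uniform algebra `A` such that `log |A⁻¹|` is uniformly dense in
the real continuous functions on `X`. -/
def IsLogmodular (A : Subalgebra ℂ C(X, ℂ)) : Prop :=
  IsUniformAlgebra A ∧ Dense (logAbsUnits A)

variable [MeasurableSpace X] [BorelSpace X]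

/-- `m` is a representing measure for the multiplicative linear functional `φ` on `A`: a regular
positive Borel measure with `φ f = ∫ f dm` for every `f ∈ A`. -/
structure IsRepresentingMeasure {A : Subalgebra ℂ C(X, ℂ)} (φ : A →ₐ[ℂ] ℂ) (m : Measure X) :
    Prop where
  regular : m.Regular
  eq_integral : ∀ f : A, φ f = ∫ x, (f : C(X, ℂ)) x ∂m

variable (A : Subalgebra ℂ C(X, ℂ)) (m : Measure X) [IsFiniteMeasure m]

/-- The generalized Hardy space `H²(m)`: the closure of `A` in `L²(m)`. -/
def H2 : Submodule ℂ (Lp ℂ 2 m) :=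
  ((Subalgebra.toSubmodule A).map
    (ContinuousMap.toLp 2 m ℂ : C(X, ℂ) →L[ℂ] Lp ℂ 2 m).toLinearMap).topologicalClosure

/-- The weak-star topology on `L^∞(m) = L¹(m)*`, given by the pairing `(h, k) ↦ ∫ h k dm`. -/
@[reducible]
def weakStar : TopologicalSpace (Lp ℂ ∞ m) :=
  TopologicalSpace.induced
    (fun (h : Lp ℂ ∞ m) (k : Lp ℂ 1 m) => ∫ x, h x * k x ∂m) Pi.topologicalSpace

/-- `H^∞(m)`: the weak-star closure of `A` in `L^∞(m)`. -/
def Hinf : Set (Lp ℂ ∞ m) :=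
  @closure _ (weakStar m) ((ContinuousMap.toLp ∞ m ℂ : C(X, ℂ) →L[ℂ] Lp ℂ ∞ m) '' A)

variable {A m}

theorem toLp_mem_H2 {a : C(X, ℂ)} (ha : a ∈ A) : ContinuousMap.toLp 2 m ℂ a ∈ H2 A m :=
  Submodule.le_topologicalClosure _ ⟨a, ha, rfl⟩

theorem smul_mem_H2_of_mem {a : C(X, ℂ)} (ha : a ∈ A) {f : Lp ℂ 2 m} (hf : f ∈ H2 A m) :
    ((ContinuousMap.toLp ∞ m ℂ a : Lp ℂ ∞ m) • f : Lp ℂ 2 m) ∈ H2 A m := by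
  have hc : Continuous
      (fun f : Lp ℂ 2 m => ((ContinuousMap.toLp ∞ m ℂ a : Lp ℂ ∞ m) • f : Lp ℂ 2 m)) :=
    (((ContinuousLinearMap.lsmul ℂ ℂ (E := ℂ)).holderL m ∞ 2 2) (ContinuousMap.toLp ∞ m ℂ a)).cont
  refine map_mem_closure hc hf ?_
  rintro _ ⟨b, hb, rfl⟩
  refine ⟨a * b, A.mul_mem ha hb, ?_⟩
  apply Lp.ext
  filter_upwards [ContinuousMap.coeFn_toLp (p := 2) (𝕜 := ℂ) m (a * b),
    ContinuousMap.coeFn_toLp (p := 2) (𝕜 := ℂ) m b,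
    ContinuousMap.coeFn_toLp (p := ∞) (𝕜 := ℂ) m a,
    Lp.coeFn_lpSMul (r := 2) (ContinuousMap.toLp ∞ m ℂ a : Lp ℂ ∞ m)
      (ContinuousMap.toLp 2 m ℂ b : Lp ℂ 2 m)] with x h1 h2 h3 h4
  simp only [ContinuousLinearMap.coe_coe]
  rw [h1, h4, Pi.smul_apply', h2, h3]
  rfl

/-- `H²(m)` is invariant under multiplication by functions in `H^∞(m)`. -/
theorem smul_mem_H2 {h : Lp ℂ ∞ m} (hh : h ∈ Hinf A m) {f : Lp ℂ 2 m} (hf : f ∈ H2 A m) :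
    (h • f : Lp ℂ 2 m) ∈ H2 A m := by
  have hcl : IsClosed (H2 A m : Set (Lp ℂ 2 m)) := Submodule.isClosed_topologicalClosure _
  have : CompleteSpace (H2 A m) := hcl.completeSpace_coe
  rw [← Submodule.orthogonal_orthogonal (H2 A m), Submodule.mem_orthogonal]
  intro g hg
  have hk : MemLp (fun x => f x * conj (g x)) 1 m :=
    (memLp_one_iff_integrable.2 ((Lp.memLp f).integrable_mul (Lp.memLp g).star))
  have key : ∀ h : Lp ℂ ∞ m,
      inner ℂ g (h • f : Lp ℂ 2 m) = ∫ x, h x * (hk.toLp _ : Lp ℂ 1 m) x ∂m := by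
    intro h
    rw [L2.inner_def]
    apply integral_congr_ae
    filter_upwards [hk.coeFn_toLp, Lp.coeFn_lpSMul (r := 2) h f] with x h1 h2
    rw [h1, h2]
    simp [mul_assoc]
  have hclosed : @IsClosed _ (weakStar m)
      {h : Lp ℂ ∞ m | ∫ x, h x * (hk.toLp _ : Lp ℂ 1 m) x ∂m = 0} := by
    let _ := weakStar m
    have : Continuous (fun h : Lp ℂ ∞ m => ∫ x, h x * (hk.toLp _ : Lp ℂ 1 m) x ∂m) :=
      (continuous_apply (hk.toLp _ : Lp ℂ 1 m)).comp
        (continuous_induced_dom (f := fun (h : Lp ℂ ∞ m) (k : Lp ℂ 1 m) => ∫ x, h x * k x ∂m))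
    exact isClosed_eq this continuous_const
  rw [key]
  have hsub : Hinf A m ⊆ {h : Lp ℂ ∞ m | ∫ x, h x * (hk.toLp _ : Lp ℂ 1 m) x ∂m = 0} := by
    refine (@IsClosed.closure_subset_iff _ (weakStar m) _ _ hclosed).2 ?_
    rintro _ ⟨a, ha, rfl⟩
    rw [Set.mem_ofPred_eq, ← key]
    exact Submodule.inner_left_of_mem_orthogonal (smul_mem_H2_of_mem ha hf) hg
  exact hsub hh

variable (A m)

/-- The multiplication operator `T_h f = h f` on `H²(m)`, for `h ∈ H^∞(m)`. -/
def mulOp (h : Hinf A m) : H2 A m →L[ℂ] H2 A m :=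
  ((((ContinuousLinearMap.lsmul ℂ ℂ (E := ℂ)).holderL m ∞ 2 2) (h : Lp ℂ ∞ m)).comp
    (H2 A m).subtypeL).codRestrict (H2 A m) (fun f => smul_mem_H2 h.2 f.2)

/-- `H²(m)` is a reproducing kernel Hilbert space: for a set `Ω` of points of the maximal ideal
space of `A` (that is, of multiplicative linear functionals on `A`), `H²(m)` is a Hilbert space of
functions on `Ω` with continuous point evaluations, where each `a ∈ A` is identified with its
Gelfand transform `ω ↦ ω a`. Here Mathlib's `RKHS` supplies an injective linear map from `H²(m)`
to the functions on `Ω` such that all point evaluations are continuous. -/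
def IsReproducingKernelHilbertSpace : Prop :=
  ∃ (Ω : Set (A →ₐ[ℂ] ℂ)) (R : RKHS ℂ (H2 A m) Ω ℂ), ∀ (a : A) (ω : Ω),
    R.coeCLM ⟨ContinuousMap.toLp 2 m ℂ (a : C(X, ℂ)), toLp_mem_H2 a.2⟩ ω = (ω : A →ₐ[ℂ] ℂ) a

end Logmodular

namespace OperatorAlgebra

variable {H : Type*} [NormedAddCommGroup H] [InnerProductSpace ℂ H]

/-- A unital operator algebra is transitive if `{0}` and `H` are its only closed invariant
subspaces. -/
def IsTransitive (T : Subalgebra ℂ (H →L[ℂ] H)) : Prop :=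
  ∀ M : Submodule ℂ H, IsClosed (M : Set H) → (∀ S ∈ T, ∀ x ∈ M, S x ∈ M) → M = ⊥ ∨ M = ⊤

/-- An operator algebra is strongly dense if it is dense in `B(H)` for the strong operator
topology, the topology of pointwise convergence. -/
def IsStronglyDense (T : Subalgebra ℂ (H →L[ℂ] H)) : Prop :=
  Dense (ContinuousLinearMap.toPointwiseConvergenceCLM ℂ (RingHom.id ℂ) H H '' (T : Set (H →L[ℂ] H)))

/-- A set of operators is catalytic if every transitive operator algebra which contains it is
strongly dense. -/
def IsCatalytic (S : Set (H →L[ℂ] H)) : Prop :=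
  ∀ T : Subalgebra ℂ (H →L[ℂ] H), S ⊆ T → IsTransitive T → IsStronglyDense T

end OperatorAlgebra

end

open Filter Topology

/-! Strong density means that orbits `{S b : S ∈ T}` of independent tuples are dense in `Hⁿ`; the
closure of such an orbit is a closed diagonally invariant subspace `N`. Induction on `n` shows that
a proper `N` satisfies a linear relation (`IsTransitive.eq_top_or_exists_relation`), which an
independent tuple excludes.

In the inductive step, a relation `c` on the part of `N` with `x 0 = 0` makes `x 0 ↦ L x = ∑ c i • x
(i + 1)` a well-defined, possibly unbounded operator on the projection of `N`, commuting with `T`.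
It must be shown to be scalar. Evaluation `e` at a point `ω` of the kernel space does this: two
vectors `f`, `g` of `H²(m)` are limits of `a j`, `c j` in `A`, and logmodularity gives units `b j`
with `|b j|` comparable to `(1 + |a j| + |c j|)⁻¹`. Then `b j * c j` and `b j * a j` are bounded
multipliers that nearly equalize `f` and `g`, while `ω (b j)` stays away from `0`. In the limit `e
(L x) / e (x 0)` does not depend on `x`, and transitivity upgrades this to `L x = a • x 0`. -/

/-- If a functional `l` vanishes on the kernel of `P`, then `l (z j) → 0` along every bounded
sequence with `P (z j) → 0`. -/
theorem tendsto_of_ker_le_ker {E F : Type*} [NormedAddCommGroup E] [InnerProductSpace ℂ E]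
    [CompleteSpace E] [NormedAddCommGroup F] [InnerProductSpace ℂ F] [CompleteSpace F]
    (P : E →L[ℂ] F) (l : E →L[ℂ] ℂ) (h : ∀ x, P x = 0 → l x = 0) {z : ℕ → E} {C : ℝ}
    (hC : ∀ j, ‖z j‖ ≤ C) (hz : Tendsto (fun j => P (z j)) atTop (𝓝 0)) :
    Tendsto (fun j => l (z j)) atTop (𝓝 0) := by
  set k : E := (InnerProductSpace.toDual ℂ E).symm l with hk
  have hl : ∀ x, l x = inner ℂ k x := fun x => by
    rw [hk, InnerProductSpace.toDual_symm_apply]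
  -- The range of `P.adjoint` need not be closed, so `k` is only approximated by some `P.adjoint v`;
  -- boundedness of `z` controls the error.
  have hmem : k ∈ closure (Set.range P.adjoint) := by
    have : k ∈ P.kerᗮ := by
      rw [Submodule.mem_orthogonal']
      intro u hu
      rw [← hl]
      exact h u hu
    rw [ContinuousLinearMap.orthogonal_ker] at this
    exact this
  rw [Metric.tendsto_atTop]
  intro ε hε
  have hC0 : 0 ≤ C := (norm_nonneg _).trans (hC 0)
  obtain ⟨_, ⟨v, rfl⟩, hv⟩ := Metric.mem_closure_iff.1 hmem (ε / (2 * (C + 1))) (by positivity)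
  have hlim : Tendsto (fun j => inner ℂ v (P (z j))) atTop (𝓝 0) := by
    simpa using (tendsto_const_nhds (x := v)).inner hz (𝕜 := ℂ)
  obtain ⟨N, hN⟩ := (Metric.tendsto_atTop.1 hlim) (ε / 2) (by positivity)
  refine ⟨N, fun j hj => ?_⟩
  have h1 := hN j hj
  rw [dist_zero_right] at h1 ⊢
  have h2 : l (z j) = inner ℂ (k - P.adjoint v) (z j) + inner ℂ v (P (z j)) := by
    rw [hl, inner_sub_left, ContinuousLinearMap.adjoint_inner_left]
    ring
  have h3 : ‖inner ℂ (k - P.adjoint v) (z j)‖ ≤ ε / 2 := by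
    refine (norm_inner_le_norm _ _).trans ?_
    rw [dist_eq_norm] at hv
    calc _ ≤ ε / (2 * (C + 1)) * (C + 1) := by
          gcongr
          exact (hC j).trans (by linarith)
      _ = ε / 2 := by field_simp
  rw [h2]
  exact (norm_add_le _ _).trans_lt (by linarith)

/-- The version of `tendsto_of_ker_le_ker` for a closed subspace of a finite power of a Hilbert
space. -/
theorem tendsto_of_ker_le_ker_pi {ι H F : Type*} [Fintype ι] [NormedAddCommGroup H]
    [InnerProductSpace ℂ H] [CompleteSpace H] [NormedAddCommGroup F] [InnerProductSpace ℂ F]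
    [CompleteSpace F] (N : Submodule ℂ (ι → H)) (hN : IsClosed (N : Set (ι → H)))
    (P : (ι → H) →L[ℂ] F) (l : (ι → H) →L[ℂ] ℂ) (h : ∀ x ∈ N, P x = 0 → l x = 0)
    {z : ℕ → ι → H} (hzN : ∀ j, z j ∈ N) {C : ℝ} (hC : ∀ j, ‖z j‖ ≤ C)
    (hz : Tendsto (fun j => P (z j)) atTop (𝓝 0)) :
    Tendsto (fun j => l (z j)) atTop (𝓝 0) := by
  -- The sup norm on `ι → H` is not Hilbertian; the equivalent `ℓ²` norm is.
  let e := PiLp.continuousLinearEquiv 2 ℂ (fun _ : ι => H)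
  let N' : Submodule ℂ (PiLp 2 fun _ : ι => H) := N.comap e.toLinearEquiv.toLinearMap
  have hN' : IsClosed (N' : Set (PiLp 2 fun _ : ι => H)) := hN.preimage e.continuous
  have : CompleteSpace N' := hN'.completeSpace_coe
  have hmem : ∀ j, e.symm (z j) ∈ N' := fun j => by
    change e (e.symm (z j)) ∈ N
    simpa using hzN j
  have := tendsto_of_ker_le_ker ((P.comp e.toContinuousLinearMap).comp N'.subtypeL)
    ((l.comp e.toContinuousLinearMap).comp N'.subtypeL) (fun x hx => h _ x.2 hx)
    (z := fun j => ⟨e.symm (z j), hmem j⟩)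
    (C := ‖(e.symm : (ι → H) →L[ℂ] (PiLp 2 fun _ : ι => H))‖ * C)
    (fun j => ((e.symm : (ι → H) →L[ℂ] (PiLp 2 fun _ : ι => H)).le_opNorm (z j)).trans
      (by gcongr; exact hC j))
    (by simpa using hz)
  simpa using this

/-! ### Diagonally invariant subspaces and strong density -/

namespace OperatorAlgebra

variable {H : Type*} [NormedAddCommGroup H] [InnerProductSpace ℂ H]

/-- For all vectors `f` and `g` there are bounded sequences `P`, `Q` in `T` such that
`P j f - Q j g → 0` while the functional `e` sees `P`, `Q` as nondegenerate multiples of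
`e g`, `e f`. -/
def HasApproxDenominators (T : Subalgebra ℂ (H →L[ℂ] H)) (e : H →L[ℂ] ℂ) : Prop :=
  ∀ f g : H, ∃ (P Q : ℕ → H →L[ℂ] H) (C : ℝ), (∀ j, P j ∈ T) ∧ (∀ j, Q j ∈ T) ∧
    (∀ j, ‖P j‖ ≤ C) ∧ (∀ j, ‖Q j‖ ≤ C) ∧ Tendsto (fun j => P j f - Q j g) atTop (𝓝 0) ∧
    ∀ u v : H, Tendsto (fun j => e (P j u - Q j v)) atTop (𝓝 0) → e g * e u = e f * e v

/-- A submodule of `Hⁿ` is invariant under the diagonal action of `T`. -/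
def IsDiagInvariant {ι : Type*} (T : Subalgebra ℂ (H →L[ℂ] H)) (N : Submodule ℂ (ι → H)) : Prop :=
  ∀ S ∈ T, ∀ x ∈ N, (fun i => S (x i)) ∈ N

variable {T : Subalgebra ℂ (H →L[ℂ] H)}

/-- An invariant, not necessarily closed, subspace is zero or dense. -/
theorem IsTransitive.eq_bot_or_dense (hT : IsTransitive T) (M : Submodule ℂ H)
    (hM : ∀ S ∈ T, ∀ x ∈ M, S x ∈ M) : M = ⊥ ∨ Dense (M : Set H) := by
  rcases hT M.topologicalClosure (Submodule.isClosed_topologicalClosure _) (fun S hS x hx =>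
    map_mem_closure S.continuous hx (fun y hy => hM S hS y hy)) with h | h
  · exact .inl (eq_bot_iff.2 (h ▸ M.le_topologicalClosure))
  · exact .inr (Submodule.dense_iff_topologicalClosure_eq_top.2 h)

/-- `L` vanishes on `N ∩ ker P`, so on `N` it factors through the first coordinate `P`. Approximate
denominators force this factor to be a scalar `a`, and `L - a • P = 0` is the new relation. -/
theorem IsTransitive.eq_top_or_exists_relation_of_exists [CompleteSpace H] (hT : IsTransitive T)
    {e : H →L[ℂ] ℂ} (he : e ≠ 0) (hTe : HasApproxDenominators T e) {k : ℕ}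
    {N : Submodule ℂ (Fin (k + 1) → H)} (hN : IsClosed (N : Set (Fin (k + 1) → H)))
    (hNT : IsDiagInvariant T N) {c : Fin k → ℂ} (hc : c ≠ 0)
    (hcN : ∀ x ∈ N, x 0 = 0 → ∑ i, c i • x i.succ = 0) :
    ∃ c : Fin (k + 1) → ℂ, c ≠ 0 ∧ ∀ x ∈ N, ∑ i, c i • x i = 0 := by
  let P : (Fin (k + 1) → H) →L[ℂ] H := ContinuousLinearMap.proj 0
  let L : (Fin (k + 1) → H) →L[ℂ] H :=
    ∑ i : Fin k, c i • (ContinuousLinearMap.proj i.succ : (Fin (k + 1) → H) →L[ℂ] H)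
  have hL : ∀ x, L x = ∑ i, c i • x i.succ := fun x => by
    simp [L]
  have hLS : ∀ (S : H →L[ℂ] H) x, L (fun i => S (x i)) = S (L x) := fun S x => by
    simp [hL, map_sum]
  -- The vectors `R j x - Q j y` stay bounded in `N` and have first coordinates tending to `0`, so
  -- `e ∘ L` tends to `0` along them.
  have key : ∀ x ∈ N, ∀ y ∈ N, e (P y) * e (L x) = e (P x) * e (L y) := by
    intro x hx y hy
    obtain ⟨R, Q, C, hR, hQ, hRC, hQC, hlim, h⟩ := hTe (P x) (P y)
    apply h
    have hC0 : 0 ≤ C := (norm_nonneg _).trans (hRC 0)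
    have := tendsto_of_ker_le_ker_pi N hN P (e.comp L)
      (fun w hw h0 => by
        rw [ContinuousLinearMap.comp_apply, hL, hcN w hw h0, map_zero])
      (z := fun j => (fun i => R j (x i)) - (fun i => Q j (y i)))
      (fun j => N.sub_mem (hNT _ (hR j) x hx) (hNT _ (hQ j) y hy))
      (C := C * ‖x‖ + C * ‖y‖)
      (fun j => (norm_sub_le _ _).trans (add_le_add
        ((pi_norm_le_iff_of_nonneg (by positivity)).2 fun i => (R j).le_of_opNorm_le_of_le
          (hRC j) (norm_le_pi_norm x i))
        ((pi_norm_le_iff_of_nonneg (by positivity)).2 fun i => (Q j).le_of_opNorm_le_of_le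
          (hQC j) (norm_le_pi_norm y i))))
      hlim
    simpa only [ContinuousLinearMap.comp_apply, map_sub, hLS] using this
  rcases hT.eq_bot_or_dense (N.map P.toLinearMap) (by
    rintro S hS _ ⟨x, hx, rfl⟩
    exact ⟨_, hNT S hS x hx, rfl⟩) with hD | hD
  · refine ⟨Pi.single 0 1, by simp, fun x hx => ?_⟩
    have : P x ∈ N.map P.toLinearMap := ⟨x, hx, rfl⟩
    rw [hD, Submodule.mem_bot] at this
    rw [Fin.sum_univ_succ]
    simpa [Pi.single_apply, P] using this
  · obtain ⟨y, hy, hey⟩ : ∃ y ∈ N, e (P y) ≠ 0 := by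
      by_contra! hcon
      apply he
      have : (e : H → ℂ) = fun _ => 0 := Continuous.ext_on hD e.continuous continuous_const (by
        rintro _ ⟨x, hx, rfl⟩
        exact hcon x hx)
      ext x
      simp [this]
    set a := e (L y) / e (P y) with ha
    have hker : ∀ x ∈ N, e ((L - a • P) x) = 0 := fun x hx => by
      have := key x hx y hy
      simp only [sub_apply, smul_apply, map_sub, map_smul,
        smul_eq_mul, ha]
      field_simp
      linear_combination this
    -- The image of `N` is invariant and lies in the kernel of `e ≠ 0`, so it is not dense.
    have hz : ∀ x ∈ N, (L - a • P) x = 0 := by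
      rcases hT.eq_bot_or_dense (N.map (L - a • P).toLinearMap) (by
        rintro S hS _ ⟨x, hx, rfl⟩
        refine ⟨_, hNT S hS x hx, ?_⟩
        simp [hLS, P]) with hR | hR
      · intro x hx
        have : (L - a • P) x ∈ N.map (L - a • P).toLinearMap := ⟨x, hx, rfl⟩
        rwa [hR, Submodule.mem_bot] at this
      · exfalso
        apply he
        have : (e : H → ℂ) = fun _ => 0 := Continuous.ext_on hR e.continuous continuous_const (by
          rintro _ ⟨x, hx, rfl⟩
          exact hker x hx)
        ext x
        simp [this]
    refine ⟨Fin.cons (-a) c, fun h0 => hc ?_, fun x hx => ?_⟩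
    · ext i
      simpa using congr_fun h0 i.succ
    · have := hz x hx
      rw [Fin.sum_univ_succ]
      simp only [Fin.cons_zero, Fin.cons_succ, ← hL]
      simp only [sub_apply, smul_apply] at this
      rw [neg_smul, neg_add_eq_sub]
      exact this

/-- A closed subspace of `Hⁿ` which is invariant under the diagonal action of a transitive algebra
with approximate denominators is everything or satisfies a linear relation. -/
theorem IsTransitive.eq_top_or_exists_relation [CompleteSpace H] (hT : IsTransitive T)
    {e : H →L[ℂ] ℂ} (he : e ≠ 0) (hTe : HasApproxDenominators T e) :
    ∀ {n : ℕ} {N : Submodule ℂ (Fin n → H)}, IsClosed (N : Set (Fin n → H)) →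
      IsDiagInvariant T N → N = ⊤ ∨ ∃ c : Fin n → ℂ, c ≠ 0 ∧ ∀ x ∈ N, ∑ i, c i • x i = 0 := by
  intro n
  induction n with
  | zero => exact fun {N} _ _ => .inl (Subsingleton.elim _ _)
  | succ k ih =>
    intro N hN hNT
    -- `J` inserts a zero first coordinate, so the induction hypothesis applies to `N ∩ {x 0 = 0}`.
    let J : (Fin k → H) →L[ℂ] (Fin (k + 1) → H) := ContinuousLinearMap.pi
      (Fin.cons 0 fun i => (ContinuousLinearMap.proj i : (Fin k → H) →L[ℂ] H))
    have hJ : ∀ g, J g = Fin.cons 0 g := fun g => by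
      ext i
      refine Fin.cases ?_ (fun i => ?_) i <;> simp [J]
    rcases ih (N := N.comap J.toLinearMap) (hN.preimage J.continuous) (fun S hS x hx => by
      have h1 := hNT S hS _ hx
      change J _ ∈ N
      convert h1 using 1
      ext i
      refine Fin.cases ?_ (fun i => ?_) i <;> simp [hJ]) with hK | ⟨c, hc, hcK⟩
    -- Here membership in `N` depends on `x 0` alone, and transitivity of `T` on `H` decides.
    · have hJN : ∀ g, J g ∈ N := fun g => by
        have : g ∈ N.comap J.toLinearMap := hK ▸ Submodule.mem_top
        exact this
      let I : H →L[ℂ] (Fin (k + 1) → H) := ContinuousLinearMap.pi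
        (Fin.cons (ContinuousLinearMap.id ℂ H) fun _ => 0)
      have hI : ∀ f, I f = Fin.cons f 0 := fun g => by
        ext i
        refine Fin.cases ?_ (fun i => ?_) i <;> simp [I]
      have hIJ : ∀ x, x = I (x 0) + J (fun i => x i.succ) := fun x => by
        ext i
        refine Fin.cases ?_ (fun i => ?_) i <;> simp [hI, hJ]
      rcases hT (N.comap I.toLinearMap) (hN.preimage I.continuous) (fun S hS x hx => by
        have h1 := hNT S hS _ hx
        change I _ ∈ N
        convert h1 using 1
        ext i
        refine Fin.cases ?_ (fun i => ?_) i <;> simp [hI]) with hD | hD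
      · right
        refine ⟨Pi.single 0 1, by simp, fun x hx => ?_⟩
        have : x 0 ∈ N.comap I.toLinearMap := by
          change I (x 0) ∈ N
          have h2 := N.sub_mem hx (hJN fun i => x i.succ)
          rwa [sub_eq_of_eq_add (hIJ x)] at h2
        rw [hD, Submodule.mem_bot] at this
        rw [Fin.sum_univ_succ]
        simpa [Pi.single_apply] using this
      · left
        rw [eq_top_iff]
        intro x _
        rw [hIJ x]
        refine N.add_mem ?_ (hJN _)
        have : x 0 ∈ N.comap I.toLinearMap := hD ▸ Submodule.mem_top
        exact this
    · right
      refine hT.eq_top_or_exists_relation_of_exists he hTe hN hNT hc fun x hx h0 => ?_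
      refine hcK (fun i => x i.succ) ?_
      change J _ ∈ N
      convert hx
      ext i
      refine Fin.cases ?_ (fun i => ?_) i <;> simp [hJ, h0]

/-- An algebra is strongly dense if it moves linearly independent finite families to arbitrary
families, up to closure. -/
theorem isStronglyDense_of_forall_linearIndependent
    (h : ∀ (n : ℕ) (b : Fin n → H), LinearIndependent ℂ b → ∀ S₀ : H →L[ℂ] H,
      (fun i => S₀ (b i)) ∈ closure ((fun (S : H →L[ℂ] H) i => S (b i)) '' (T : Set (H →L[ℂ] H)))) :
    IsStronglyDense T := by
  intro S₁
  obtain ⟨S₀, rfl⟩ : ∃ S₀ : H →L[ℂ] H,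
    ContinuousLinearMap.toPointwiseConvergenceCLM ℂ (RingHom.id ℂ) H H S₀ = S₁ := ⟨S₁, rfl⟩
  have hemb := PointwiseConvergenceCLM.isEmbedding_coeFn (RingHom.id ℂ) H H
  rw [hemb.closure_eq_preimage_closure_image, Set.mem_preimage, mem_closure_iff_nhds_basis
      (by rw [nhds_pi]; exact hasBasis_pi fun _ => Metric.nhds_basis_ball)]
  rintro ⟨I, ε⟩ ⟨hI, hε⟩
  let V := Submodule.span ℂ I
  have : FiniteDimensional ℂ V := FiniteDimensional.span_of_finite ℂ hI
  let b := Module.finBasis ℂ V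
  have hsum : ∀ (S : H →L[ℂ] H) (x : V), ∑ i, b.repr x i • S (b i) = S x := fun S x => by
    have := congr_arg (S.comp V.subtypeL) (b.sum_repr x)
    simp only [map_sum, map_smul] at this
    exact this
  -- A basic neighbourhood tests a finite set `I`; by linearity this is an open condition on the
  -- values at a basis of its span.
  let U : Set (Fin (Module.finrank ℂ V) → H) :=
    ⋂ x ∈ {x : V | (x : H) ∈ I}, {v | ∑ i, b.repr x i • v i ∈ Metric.ball (S₀ x) (ε x)}
  have hfin : {x : V | (x : H) ∈ I}.Finite := hI.preimage Subtype.val_injective.injOn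
  have hU : IsOpen U := hfin.isOpen_biInter fun x _ =>
    Metric.isOpen_ball.preimage (by fun_prop)
  obtain ⟨_, hv, S, hS, rfl⟩ := mem_closure_iff.1
    (h _ (fun i => (b i : H)) (b.linearIndependent.map' V.subtype (Submodule.ker_subtype V)) S₀)
    U hU (by
      simp only [U, Set.mem_iInter]
      intro x hx
      change _ ∈ Metric.ball _ _
      rw [hsum]
      exact Metric.mem_ball_self (hε _ hx))
  refine ⟨_, ⟨_, ⟨S, hS, rfl⟩, rfl⟩, fun x hx => ?_⟩
  simp only [U, Set.mem_iInter] at hv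
  have h1 : ∑ i, b.repr _ i • S (b i) ∈ Metric.ball _ _ := hv ⟨x, Submodule.subset_span hx⟩ hx
  rw [hsum] at h1
  exact h1

/-- A transitive operator algebra with approximate denominators for a nonzero functional is
strongly dense. -/
theorem IsTransitive.isStronglyDense [CompleteSpace H] (hT : IsTransitive T)
    {e : H →L[ℂ] ℂ} (he : e ≠ 0) (hTe : HasApproxDenominators T e) : IsStronglyDense T := by
  refine isStronglyDense_of_forall_linearIndependent fun n b hb S₀ => ?_
  let E : (H →L[ℂ] H) →ₗ[ℂ] (Fin n → H) :=
    { toFun := fun S i => S (b i)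
      map_add' := fun _ _ => rfl
      map_smul' := fun _ _ => rfl }
  let N := ((Subalgebra.toSubmodule T).map E).topologicalClosure
  have hN : N = ⊤ := by
    rcases hT.eq_top_or_exists_relation he hTe (N := N)
      (Submodule.isClosed_topologicalClosure _) (fun S hS x hx =>
        map_mem_closure (f := fun (x : Fin n → H) i => S (x i)) (by fun_prop) hx (by
          rintro _ ⟨R, hR, rfl⟩
          exact ⟨S * R, T.mul_mem hS hR, rfl⟩)) with h | ⟨c, hc, h⟩
    · exact h
    · refine absurd (funext ?_) hc
      exact Fintype.linearIndependent_iff.1 hb c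
        (h b (Submodule.le_topologicalClosure _ ⟨1, T.one_mem, rfl⟩))
  have : (fun i => S₀ (b i)) ∈ N := hN ▸ Submodule.mem_top
  exact this

end OperatorAlgebra

/-! ### Approximate denominators from logmodularity -/

theorem MeasureTheory.Lp.norm_le_mul_add_of_ae_le {α : Type*} [MeasurableSpace α] {μ : Measure α}
    {E : Type*} [NormedAddCommGroup E] {p : ℝ≥0∞} [Fact (1 ≤ p)] {c : ℝ} (hc : 0 ≤ c)
    {f u v w : Lp E p μ} (h : ∀ᵐ x ∂μ, ‖f x‖ ≤ c * (‖u x‖ + ‖v x‖ + ‖w x‖)) :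
    ‖f‖ ≤ c * (‖u‖ + ‖v‖ + ‖w‖) := by
  have key : ∀ g : Lp E p μ, ‖(Lp.memLp g).norm.toLp _‖ = ‖g‖ := fun g => by
    rw [Lp.norm_toLp, eLpNorm_norm, Lp.norm_def]
  have h1 : ‖f‖ ≤ c * ‖(Lp.memLp u).norm.toLp _ + (Lp.memLp v).norm.toLp _ +
      (Lp.memLp w).norm.toLp _‖ := by
    apply Lp.norm_le_mul_norm_of_ae_le_mul
    filter_upwards [h, (Lp.memLp u).norm.coeFn_toLp, (Lp.memLp v).norm.coeFn_toLp,
      (Lp.memLp w).norm.coeFn_toLp,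
      Lp.coeFn_add ((Lp.memLp u).norm.toLp _ + (Lp.memLp v).norm.toLp _)
        ((Lp.memLp w).norm.toLp _),
      Lp.coeFn_add ((Lp.memLp u).norm.toLp _) ((Lp.memLp v).norm.toLp _)] with x hx h1 h2 h3 h4 h5
    rw [h4, Pi.add_apply, h5, Pi.add_apply, h1, h2, h3, Real.norm_of_nonneg (by positivity)]
    exact hx
  refine h1.trans (mul_le_mul_of_nonneg_left ?_ hc)
  refine (norm_add₃_le).trans ?_
  rw [key, key, key]

namespace Logmodular

variable {X : Type*} [TopologicalSpace X] [CompactSpace X]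

/-- In a logmodular algebra, every positive continuous function is within a factor `e` of the
modulus of an invertible element. -/
theorem IsLogmodular.exists_unit_norm_le {A : Subalgebra ℂ C(X, ℂ)} (hA : IsLogmodular A)
    (w : C(X, ℝ)) (hw : ∀ x, 0 < w x) :
    ∃ b : Aˣ, ∀ x, ‖((b : A) : C(X, ℂ)) x‖ ≤ Real.exp 1 * w x ∧
      ‖((b⁻¹ : Aˣ) : C(X, ℂ)) x‖ ≤ Real.exp 1 * (w x)⁻¹ := by
  let u : C(X, ℝ) := ⟨fun x => Real.log (w x), w.continuous.log fun x => (hw x).ne'⟩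
  -- Uniform distance `1` between logarithms becomes the factor `Real.exp 1`.
  obtain ⟨v, ⟨b, hb⟩, hv⟩ := Metric.mem_closure_iff.1 (hA.2 u) 1 one_pos
  refine ⟨b, fun x => ?_⟩
  have hmul : ((b : A) : C(X, ℂ)) x * ((b⁻¹ : Aˣ) : C(X, ℂ)) x = 1 := by
    have : ((b : A) * ((b⁻¹ : Aˣ) : A) : A) = 1 := b.mul_inv
    exact congr_arg (fun a : A => (a : C(X, ℂ)) x) this
  have hb0 : ((b : A) : C(X, ℂ)) x ≠ 0 := left_ne_zero_of_mul_eq_one hmul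
  have hinv : ((b⁻¹ : Aˣ) : C(X, ℂ)) x = (((b : A) : C(X, ℂ)) x)⁻¹ := eq_inv_of_mul_eq_one_right hmul
  have hpos : 0 < ‖((b : A) : C(X, ℂ)) x‖ := norm_pos_iff.2 hb0
  have hd : |Real.log (w x) - Real.log ‖((b : A) : C(X, ℂ)) x‖| < 1 := by
    have := (ContinuousMap.dist_apply_le_dist (f := u) (g := v) x).trans_lt hv
    rwa [Real.dist_eq, hb x] at this
  rw [abs_lt] at hd
  rw [hinv, norm_inv]
  constructor
  · rw [← Real.log_le_log_iff hpos (by have := hw x; positivity),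
      Real.log_mul (Real.exp_ne_zero _) (hw x).ne', Real.log_exp]
    linarith
  · rw [← Real.log_le_log_iff (by positivity) (by have := hw x; positivity),
      Real.log_mul (Real.exp_ne_zero _) (inv_pos.2 (hw x)).ne', Real.log_exp, Real.log_inv,
      Real.log_inv]
    linarith

variable [MeasurableSpace X] [BorelSpace X] (A : Subalgebra ℂ C(X, ℂ)) (m : Measure X)
  [IsFiniteMeasure m]

/-- The image of `a : A` in `H²(m)`. -/
noncomputable def toH2 (a : A) : H2 A m :=
  ⟨ContinuousMap.toLp 2 m ℂ (a : C(X, ℂ)), toLp_mem_H2 a.2⟩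

/-- Multiplication by an element of `A` as an operator on `H²(m)`. -/
noncomputable def mulA (a : A) : H2 A m →L[ℂ] H2 A m :=
  mulOp A m ⟨ContinuousMap.toLp ∞ m ℂ (a : C(X, ℂ)),
    @subset_closure _ (weakStar m) _ _ ⟨a, a.2, rfl⟩⟩

variable {A m}

theorem coeFn_toH2 (a : A) : ((toH2 A m a : Lp ℂ 2 m) : X → ℂ) =ᵐ[m] (a : C(X, ℂ)) :=
  ContinuousMap.coeFn_toLp m _

theorem coeFn_mulA (a : A) (f : H2 A m) :
    ((mulA A m a f : Lp ℂ 2 m) : X → ℂ) =ᵐ[m] fun x => (a : C(X, ℂ)) x * (f : Lp ℂ 2 m) x := by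
  filter_upwards [ContinuousMap.coeFn_toLp (p := ∞) (𝕜 := ℂ) m (a : C(X, ℂ)),
    ContinuousLinearMap.coeFn_holder (r := 2) (ContinuousLinearMap.lsmul ℂ ℂ (E := ℂ))
      (ContinuousMap.toLp ∞ m ℂ (a : C(X, ℂ))) (f : Lp ℂ 2 m)] with x h1 h2
  rw [← h1]
  exact h2

theorem mulA_toH2 (a b : A) : mulA A m a (toH2 A m b) = toH2 A m (a * b) := by
  apply Subtype.ext
  apply Lp.ext
  filter_upwards [coeFn_mulA a (toH2 A m b), coeFn_toH2 (m := m) (a * b),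
    coeFn_toH2 (m := m) b] with x h1 h2 h3
  rw [h1, h2, h3]
  rfl

theorem norm_mulA_le {a : A} {C : ℝ} (hC0 : 0 ≤ C) (hC : ∀ x, ‖(a : C(X, ℂ)) x‖ ≤ C) :
    ‖mulA A m a‖ ≤ C := by
  refine ContinuousLinearMap.opNorm_le_bound _ hC0 fun f => ?_
  apply Lp.norm_le_mul_norm_of_ae_le_mul
  filter_upwards [coeFn_mulA a f] with x hx
  change ‖(mulA A m a f : Lp ℂ 2 m) x‖ ≤ C * ‖(f : Lp ℂ 2 m) x‖
  rw [hx, norm_mul]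
  exact mul_le_mul_of_nonneg_right (hC x) (norm_nonneg _)

theorem denseRange_toH2 : DenseRange (toH2 A m) := by
  intro f
  rw [closure_subtype]
  have := f.2
  refine closure_mono ?_ this
  rintro _ ⟨a, ha, rfl⟩
  exact ⟨toH2 A m ⟨a, ha⟩, ⟨_, rfl⟩, rfl⟩

/-- A bounded functional extending a character of `A` is multiplicative for the action of `A`. -/
theorem apply_mulA {ω : A →ₐ[ℂ] ℂ} {e : H2 A m →L[ℂ] ℂ} (he : ∀ a, e (toH2 A m a) = ω a)
    (a : A) (f : H2 A m) : e (mulA A m a f) = ω a * e f := by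
  have : (fun f => e (mulA A m a f)) = fun f => ω a * e f := by
    refine denseRange_toH2.equalizer (by fun_prop) (by fun_prop) ?_
    ext b
    simp only [Function.comp_apply, mulA_toH2, he, map_mul]
  exact congr_fun this f

/-- Approximation of the quotients of two functions in `H²(m)`: with `a j → f`, `c j → g` in `A`,
there are invertible `b j` such that `b j * a j`, `b j * c j` and, in `L²(m)`, `(b j)⁻¹` are
bounded, and `b j * c j * f - b j * a j * g → 0`. -/
theorem IsLogmodular.hasApproxDenominators (hA : IsLogmodular A) {ω : A →ₐ[ℂ] ℂ}
    {e : H2 A m →L[ℂ] ℂ} (he : ∀ a, e (toH2 A m a) = ω a)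
    {T : Subalgebra ℂ (H2 A m →L[ℂ] H2 A m)} (hT : Set.range (mulOp A m) ⊆ T) :
    OperatorAlgebra.HasApproxDenominators T e := by
  have hTA : ∀ a, mulA A m a ∈ T := fun a => hT ⟨_, rfl⟩
  intro f g
  obtain ⟨a', ha', ha⟩ := mem_closure_iff_seq_limit.1 (denseRange_toH2 f)
  obtain ⟨c', hc', hc⟩ := mem_closure_iff_seq_limit.1 (denseRange_toH2 g)
  choose a haa using ha'
  choose c hcc using hc'
  obtain rfl : (fun j => toH2 A m (a j)) = a' := funext haa
  obtain rfl : (fun j => toH2 A m (c j)) = c' := funext hcc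
  let w : ℕ → C(X, ℝ) := fun j =>
    ⟨fun x => (1 + ‖(a j : C(X, ℂ)) x‖ + ‖(c j : C(X, ℂ)) x‖)⁻¹,
      Continuous.inv₀ (by fun_prop) fun x => by positivity⟩
  have hw : ∀ j x, w j x = (1 + ‖(a j : C(X, ℂ)) x‖ + ‖(c j : C(X, ℂ)) x‖)⁻¹ := fun _ _ => rfl
  choose b hb hbi using fun j => show ∃ b : Aˣ,
      (∀ x, ‖((b : A) : C(X, ℂ)) x‖ * (1 + ‖(a j : C(X, ℂ)) x‖ + ‖(c j : C(X, ℂ)) x‖) ≤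
        Real.exp 1) ∧
      ∀ x, ‖((b⁻¹ : Aˣ) : C(X, ℂ)) x‖ ≤
        Real.exp 1 * (1 + ‖(a j : C(X, ℂ)) x‖ + ‖(c j : C(X, ℂ)) x‖) by
    obtain ⟨b, hb⟩ := hA.exists_unit_norm_le (w j) fun x => by rw [hw]; positivity
    refine ⟨b, fun x => ?_, fun x => ?_⟩
    · have := (hb x).1
      rwa [hw, ← div_eq_mul_inv, le_div_iff₀ (by positivity)] at this
    · have := (hb x).2
      rwa [hw, inv_inv] at this
  have hbound : ∀ j, ∀ d : A, (∀ x, ‖(d : C(X, ℂ)) x‖ ≤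
      1 + ‖(a j : C(X, ℂ)) x‖ + ‖(c j : C(X, ℂ)) x‖) →
      ‖mulA A m ((b j : A) * d)‖ ≤ Real.exp 1 := fun j d hd => by
    refine norm_mulA_le (Real.exp_pos _).le fun x => ?_
    have : (((b j : A) * d : A) : C(X, ℂ)) x = ((b j : A) : C(X, ℂ)) x * (d : C(X, ℂ)) x := rfl
    rw [this, norm_mul]
    exact (mul_le_mul_of_nonneg_left (hd x) (norm_nonneg _)).trans (hb j x)
  refine ⟨fun j => mulA A m ((b j : A) * c j), fun j => mulA A m ((b j : A) * a j), Real.exp 1,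
    fun j => hTA _, fun j => hTA _,
    fun j => hbound j _ fun x => by linarith [norm_nonneg ((a j : C(X, ℂ)) x)],
    fun j => hbound j _ fun x => by linarith [norm_nonneg ((c j : C(X, ℂ)) x)], ?_, ?_⟩
  · have hle : ∀ j, ‖mulA A m ((b j : A) * c j) f - mulA A m ((b j : A) * a j) g‖ ≤
        Real.exp 1 * (‖toH2 A m (a j) - f‖ + ‖toH2 A m (c j) - g‖ + ‖(0 : H2 A m)‖) := by
      intro j
      refine Lp.norm_le_mul_add_of_ae_le (Real.exp_pos 1).le
        (f := ((mulA A m ((b j : A) * c j) f - mulA A m ((b j : A) * a j) g : H2 A m) : Lp ℂ 2 m))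
        (u := ((toH2 A m (a j) - f : H2 A m) : Lp ℂ 2 m))
        (v := ((toH2 A m (c j) - g : H2 A m) : Lp ℂ 2 m)) (w := ((0 : H2 A m) : Lp ℂ 2 m)) ?_
      simp only [Submodule.coe_sub]
      filter_upwards [coeFn_mulA ((b j : A) * c j) f, coeFn_mulA ((b j : A) * a j) g,
        coeFn_toH2 (m := m) (a j), coeFn_toH2 (m := m) (c j),
        Lp.coeFn_sub (mulA A m ((b j : A) * c j) f : Lp ℂ 2 m) (mulA A m ((b j : A) * a j) g),
        Lp.coeFn_sub (toH2 A m (a j) : Lp ℂ 2 m) f,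
        Lp.coeFn_sub (toH2 A m (c j) : Lp ℂ 2 m) g] with x h1 h2 h3 h4 h5 h6 h7
      rw [h5, h6, h7, Pi.sub_apply, Pi.sub_apply, Pi.sub_apply, h1, h2, h3, h4]
      set F := (f : Lp ℂ 2 m) x
      set G := (g : Lp ℂ 2 m) x
      have hbx := hb j x
      have e1 : (((b j : A) * c j : A) : C(X, ℂ)) x = ((b j : A) : C(X, ℂ)) x * (c j : C(X, ℂ)) x := rfl
      have e2 : (((b j : A) * a j : A) : C(X, ℂ)) x = ((b j : A) : C(X, ℂ)) x * (a j : C(X, ℂ)) x := rfl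
      rw [e1, e2]
      set B := ((b j : A) : C(X, ℂ)) x
      set α := (a j : C(X, ℂ)) x
      set γ := (c j : C(X, ℂ)) x
      -- The cross term `γ * α - α * γ` cancels, leaving only the errors `γ - G` and `α - F`, whose
      -- coefficients are absorbed by `B`.
      have e3 : B * γ * F - B * α * G = B * (α * (γ - G) - γ * (α - F)) := by ring
      have e4 : ‖α * (γ - G) - γ * (α - F)‖ ≤
          (1 + ‖α‖ + ‖γ‖) * (‖α - F‖ + ‖γ - G‖) := by
        refine (norm_sub_le _ _).trans ?_
        rw [norm_mul, norm_mul]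
        nlinarith [norm_nonneg α, norm_nonneg γ, norm_nonneg (α - F), norm_nonneg (γ - G),
          mul_nonneg (norm_nonneg α) (norm_nonneg (α - F)),
          mul_nonneg (norm_nonneg γ) (norm_nonneg (γ - G))]
      rw [e3, norm_mul]
      calc ‖B‖ * ‖α * (γ - G) - γ * (α - F)‖
          ≤ ‖B‖ * ((1 + ‖α‖ + ‖γ‖) * (‖α - F‖ + ‖γ - G‖)) := by gcongr
        _ = (‖B‖ * (1 + ‖α‖ + ‖γ‖)) * (‖α - F‖ + ‖γ - G‖) := by ring
        _ ≤ Real.exp 1 * (‖α - F‖ + ‖γ - G‖) := by gcongr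
        _ ≤ _ := by
          exact mul_le_mul_of_nonneg_left (le_add_of_nonneg_right (norm_nonneg _))
            (Real.exp_pos 1).le
    refine squeeze_zero_norm hle ?_
    have h1 := (tendsto_iff_norm_sub_tendsto_zero.1 ha)
    have h2 := (tendsto_iff_norm_sub_tendsto_zero.1 hc)
    simpa using ((h1.add h2).add_const ‖(0 : H2 A m)‖).const_mul (Real.exp 1)
  · intro u v huv
    have hωa : Tendsto (fun j => ω (a j)) atTop (𝓝 (e f)) := by
      simpa only [he, Function.comp_def] using (e.continuous.tendsto f).comp ha
    have hωc : Tendsto (fun j => ω (c j)) atTop (𝓝 (e g)) := by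
      simpa only [he, Function.comp_def] using (e.continuous.tendsto g).comp hc
    have hinv : ∀ j, ω ((b j)⁻¹ : Aˣ) * ω (b j) = 1 := fun j => by
      rw [← map_mul, Units.inv_mul, map_one]
    -- `e` is bounded for the `L²` norm, so the pointwise bound on `(b j)⁻¹` by `L²`-bounded
    -- functions suffices, although no uniform sup bound is available.
    have hbd : ∀ j, ‖ω ((b j)⁻¹ : Aˣ)‖ ≤ ‖e‖ * (Real.exp 1 *
        (‖toH2 A m 1‖ + ‖toH2 A m (a j)‖ + ‖toH2 A m (c j)‖)) := fun j => by
      rw [← he]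
      refine e.le_opNorm_of_le ?_
      refine Lp.norm_le_mul_add_of_ae_le (Real.exp_pos 1).le
        (f := (toH2 A m ((b j)⁻¹ : Aˣ) : Lp ℂ 2 m)) (u := (toH2 A m 1 : Lp ℂ 2 m))
        (v := (toH2 A m (a j) : Lp ℂ 2 m)) (w := (toH2 A m (c j) : Lp ℂ 2 m)) ?_
      filter_upwards [coeFn_toH2 (m := m) ((b j)⁻¹ : Aˣ).1, coeFn_toH2 (A := A) (m := m) 1,
        coeFn_toH2 (m := m) (a j), coeFn_toH2 (m := m) (c j)] with x h1 h2 h3 h4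
      rw [h1, h2, h3, h4]
      simpa using hbi j x
    have hbdd : IsBoundedUnder (· ≤ ·) atTop (fun j => ‖ω ((b j)⁻¹ : Aˣ)‖) :=
      ((((ha.norm.const_add ‖toH2 A m 1‖).add hc.norm).const_mul
        (Real.exp 1)).const_mul ‖e‖).isBoundedUnder_le.mono_le (.of_forall hbd)
    -- Multiplying by the bounded `ω ((b j)⁻¹)` removes the factor `ω (b j)` from the null sequence.
    have hz := NormedField.tendsto_zero_smul_of_tendsto_zero_of_bounded huv hbdd
    have heq : ∀ j, e (mulA A m ((b j : A) * c j) u - mulA A m ((b j : A) * a j) v) • ω ((b j)⁻¹ : Aˣ) =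
        ω (c j) * e u - ω (a j) * e v := fun j => by
      rw [map_sub, apply_mulA he, apply_mulA he, map_mul, map_mul, smul_eq_mul]
      linear_combination (ω (c j) * e u - ω (a j) * e v) * hinv j
    have := tendsto_nhds_unique (hz.congr heq) ((hωc.mul_const (e u)).sub (hωa.mul_const (e v)))
    exact (sub_eq_zero.1 this.symm)

end Logmodular

/-! ### Conclusion -/

theorem theorem3p6 {X : Type*} [TopologicalSpace X] [CompactSpace X] [T2Space X]
    [MeasurableSpace X] [BorelSpace X]
    (A : Subalgebra ℂ C(X, ℂ)) (hA : Logmodular.IsLogmodular A)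
    (φ : A →ₐ[ℂ] ℂ) (m : Measure X) [IsFiniteMeasure m]
    (hm : Logmodular.IsRepresentingMeasure φ m)
    (hH : Logmodular.IsReproducingKernelHilbertSpace A m) :
    OperatorAlgebra.IsCatalytic (Set.range (Logmodular.mulOp A m)) := by
  intro T hT hTrans
  obtain ⟨Ω, R, hR⟩ := hH
  have : CompleteSpace (Logmodular.H2 A m) :=
    (Submodule.isClosed_topologicalClosure _).completeSpace_coe
  rcases isEmpty_or_nonempty Ω with hΩ | ⟨⟨ω⟩⟩
  -- With no evaluation points, injectivity into functions on `Ω` forces `H²(m) = 0`.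
  · have : Subsingleton (Logmodular.H2 A m) := R.coeCLM_injective.subsingleton
    intro S
    refine subset_closure ⟨0, T.zero_mem, ?_⟩
    exact DFunLike.ext _ _ fun x => Subsingleton.elim (α := Logmodular.H2 A m) _ _
  · let e : Logmodular.H2 A m →L[ℂ] ℂ := (ContinuousLinearMap.proj ω).comp R.coeCLM
    have he : ∀ a, e (Logmodular.toH2 A m a) = (ω : A →ₐ[ℂ] ℂ) a := fun a => hR a ω
    have he0 : e ≠ 0 := fun h0 => by
      have := he 1
      simp [h0] at this
    exact hTrans.isStronglyDense he0 (hA.hasApproxDenominators he hT)
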